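/- Let $E_1,E_2$ be finite-dimensional real inner product spaces, let $D\subseteq E_1$ be nonempty and convex, and let $F\colon D\to E_2$. A cone is a nonempty set closed under multiplication by scalars $\lambda\ge 0$. For a cone $K\subseteq E_2$, say that $F$ is $K$-closed (respectively $K$-convex) if the $K$-epigraph $\{(x,y)\in D\times E_2 : y-F(x)\in K\}$ is closed (respectively convex) in $E_1\times E_2$. Suppose that there is a smallest closed convex cone $\hat K_F\subseteq E_2$ such that $F$ is $\hat K_F$-closed and $\hat K_F$-convex, and let $\hat K_F^\circ=\{v\in E_2 : \langle u,v\rangle\le 0\ \text{for all } u\in\hat K_F\}$ be its polar cone. For $u\in E_2$ let $\langle u,F\rangle\colon E_1\to\mathbb R\cup\{+\infty\}$ be equal to $\langle u,F(x)\rangle$ for $x\in D$ and to $+\infty$ for $x\notin D$. Let $\Gamma_0(E_1)$ be the set of all proper convex functions $f\colon E_1\to\mathbb R\cup\{+\infty\}$ whose epigraph $\operatorname{epi} f=\{(x,\alpha)\in E_1\times\mathbb R: f(x)\le\alpha\}$ is closed, and let $\Gamma_0(D)$ be the set of all proper convex functions $f\colon E_1\to\mathbb R\cup\{+\infty\}$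 that are $D$-closed, that is, for which $\operatorname{epi} f\cap(D\times\mathbb R)$ is closed in the subspace topology of $D\times\mathbb R$. Then $$-\hat K_F^\circ=\operatorname{cl}\{u\in E_2 : \langle u,F\rangle\in\Gamma_0(E_1)\}=\operatorname{cl}\{u\in E_2 : \langle u,F\rangle\in\Gamma_0(D)\}.$$ -/

import Mathlib

open scoped Pointwise RealInnerProductSpace

namespace KConvex

/-- A cone: a nonempty set that is stable under multiplication by all scalars `t ≥ 0`. -/
def IsCone {E : Type*} [AddCommGroup E] [Module ℝ E] (K : Set E) : Prop :=
  K.Nonempty ∧ ∀ x ∈ K, ∀ t : ℝ, 0 ≤ t → t • x ∈ K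

/-- The polar cone `K° = {v | ∀ u ∈ K, ⟪u, v⟫ ≤ 0}`. The dual cone of `K` is `-K°`. -/
def polarCone {E : Type*} [NormedAddCommGroup E] [InnerProductSpace ℝ E] (K : Set E) : Set E :=
  {v | ∀ u ∈ K, ⟪u, v⟫ ≤ 0}

/-! ### Extended-real-valued functions -/

/-- The epigraph of `f : E → [-∞, ∞]`, a subset of `E × ℝ`. -/
def epi {E : Type*} (f : E → EReal) : Set (E × ℝ) :=
  {p | f p.1 ≤ (p.2 : EReal)}

/-- `f` is proper: its domain is nonempty and it does not take the value `-∞`. -/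
def IsProperFun {E : Type*} (f : E → EReal) : Prop :=
  (∃ x, f x < ⊤) ∧ ∀ x, f x ≠ ⊥

/-- `Γ(E)`: the proper convex functions `E → ℝ ∪ {+∞}`. -/
def Gamma (E : Type*) [AddCommGroup E] [Module ℝ E] : Set (E → EReal) :=
  {f | IsProperFun f ∧ Convex ℝ (epi f)}

/-- `Γ₀(E)`: the functions in `Γ(E)` that are closed, that is, have a closed epigraph. -/
def GammaZero (E : Type*) [AddCommGroup E] [Module ℝ E] [TopologicalSpace E] :
    Set (E → EReal) :=
  {f | f ∈ Gamma E ∧ IsClosed (epi f)}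

/-- `f` is `D`-closed: (the trace of) its epigraph is closed in the subspace `D × ℝ` of
`E × ℝ`. -/
def IsClosedRel {E : Type*} [TopologicalSpace E] (D : Set E) (f : E → EReal) : Prop :=
  IsClosed {p : ↥(D ×ˢ (Set.univ : Set ℝ)) | (p : E × ℝ) ∈ epi f}

/-- `Γ₀(D)`: the functions in `Γ(E)` that are `D`-closed. -/
def GammaZeroOn {E : Type*} [AddCommGroup E] [Module ℝ E] [TopologicalSpace E] (D : Set E) :
    Set (E → EReal) :=
  {f | f ∈ Gamma E ∧ IsClosedRel D f}

/-! ### Vector-valued maps `F : D → E₂` with `D ⊆ E₁` -/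

open Classical in
/-- The scalarization `⟨u, F⟩ : E₁ → ℝ ∪ {+∞}`, equal to `⟪u, F x⟫` for `x ∈ D` and to `+∞`
elsewhere. -/
noncomputable def scalarization {E₁ E₂ : Type*} [NormedAddCommGroup E₂]
    [InnerProductSpace ℝ E₂] {D : Set E₁} (u : E₂) (F : D → E₂) : E₁ → EReal :=
  fun x => if h : x ∈ D then ((⟪u, F ⟨x, h⟩⟫ : ℝ) : EReal) else ⊤

/-- The `K`-epigraph `{(x, y) ∈ D × E₂ | F x ≤_K y}`, where `F x ≤_K y` means `y - F x ∈ K`. -/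
def kEpi {E₁ E₂ : Type*} [AddCommGroup E₂] {D : Set E₁} (K : Set E₂) (F : D → E₂) :
    Set (E₁ × E₂) :=
  {p | ∃ h : p.1 ∈ D, p.2 - F ⟨p.1, h⟩ ∈ K}

/-- `K` is the cone `K̂_F`: the smallest closed convex cone such that `F` is closed and convex with
respect to it, that is, such that the corresponding epigraph of `F` is closed and convex. -/
def IsSmallestCone {E₁ E₂ : Type*} [NormedAddCommGroup E₁] [InnerProductSpace ℝ E₁]
    [NormedAddCommGroup E₂] [InnerProductSpace ℝ E₂] {D : Set E₁} (F : D → E₂)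
    (K : Set E₂) : Prop :=
  IsLeast {C : Set E₂ | IsCone C ∧ IsClosed C ∧ Convex ℝ C ∧
    IsClosed (kEpi C F) ∧ Convex ℝ (kEpi C F)} K

end KConvex

namespace KConvex

open Filter Topology

section Cone

variable {E : Type*} [NormedAddCommGroup E] [InnerProductSpace ℝ E]

/-! The three sets form a cycle of inclusions; `GammaZero ⊆ GammaZeroOn` is immediate. If `⟨u, F⟩`
is convex and `D`-closed, then cutting `K` with the half-space `⟪u, ·⟫ ≥ 0` leaves an admissible
cone, so minimality puts `K` inside that half-space (`IsSmallestCone.mem_neg_polarCone`).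
Conversely, a dual vector `u` always gives a convex scalarization, but its epigraph may fail to be
closed. It is closed when `u` is strictly positive on the nonzero part of `K` orthogonal to the
lineality space (`isClosed_epi_scalarization`). Some dual `u₀` has this property, and then so does
`u + t • u₀` for every `t > 0`; let `t → 0`. -/

theorem mem_neg_polarCone {K : Set E} {u : E} :
    u ∈ -polarCone K ↔ ∀ k ∈ K, 0 ≤ ⟪u, k⟫ := by
  simp only [polarCone, Set.mem_neg, Set.mem_ofPred_eq, inner_neg_right, neg_nonpos]
  exact forall₂_congr fun k _ => by rw [real_inner_comm]

theorem isClosed_neg_polarCone (K : Set E) : IsClosed (-polarCone K) := by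
  have h : -polarCone K = ⋂ k ∈ K, {u : E | 0 ≤ ⟪u, k⟫} := by
    ext u
    rw [mem_neg_polarCone]
    simp
  rw [h]
  exact isClosed_biInter fun k _ => isClosed_le continuous_const (by fun_prop)

theorem IsCone.zero_mem {K : Set E} (hK : IsCone K) : (0 : E) ∈ K := by
  obtain ⟨x, hx⟩ := hK.1
  simpa using hK.2 x hx 0 le_rfl

theorem IsCone.add_mem {K : Set E} (hK : IsCone K) (hconv : Convex ℝ K) {x y : E}
    (hx : x ∈ K) (hy : y ∈ K) : x + y ∈ K := by
  have h := hK.2 _ (hconv hx hy (by norm_num : (0 : ℝ) ≤ 1 / 2) (by norm_num : (0 : ℝ) ≤ 1 / 2)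
    (by norm_num)) 2 (by norm_num)
  simpa [smul_smul, ← smul_add] using h

/-- The lineality space `K ∩ -K` of a convex cone `K`. -/
def lineality (K : Set E) (hK : IsCone K) (hconv : Convex ℝ K) : Submodule ℝ E where
  carrier := {x | x ∈ K ∧ -x ∈ K}
  add_mem' := fun {x y} hx hy =>
    ⟨hK.add_mem hconv hx.1 hy.1, by rw [neg_add]; exact hK.add_mem hconv hx.2 hy.2⟩
  zero_mem' := ⟨hK.zero_mem, by simpa using hK.zero_mem⟩
  smul_mem' := fun c x hx => by
    rcases le_total 0 c with hc | hc
    · exact ⟨hK.2 _ hx.1 c hc, by rw [← smul_neg]; exact hK.2 _ hx.2 c hc⟩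
    · have hc' : 0 ≤ -c := by linarith
      exact ⟨by simpa using hK.2 _ hx.2 (-c) hc', by simpa using hK.2 _ hx.1 (-c) hc'⟩

/-- A point outside a closed convex cone is strictly separated from it by an element of the dual
cone. -/
theorem IsCone.exists_mem_neg_polarCone_inner_neg [CompleteSpace E] {K : Set E} (hK : IsCone K)
    (hconv : Convex ℝ K) (hclosed : IsClosed K) {z : E} (hz : z ∉ K) :
    ∃ v ∈ -polarCone K, ⟪v, z⟫ < 0 := by
  obtain ⟨f, r, hfz, hfK⟩ := geometric_hahn_banach_point_closed hconv hclosed hz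
  have hr : r < 0 := by simpa using hfK 0 hK.zero_mem
  refine ⟨(InnerProductSpace.toDual ℝ E).symm f, mem_neg_polarCone.2 fun k hk => ?_, ?_⟩
  · rw [InnerProductSpace.toDual_symm_apply]
    by_contra! hneg
    -- The factor scales `k` to a point of `K` where `f` equals `r`, against the strict bound `r <
    -- f` on `K`.
    have h := hfK _ (hK.2 k hk (r / f k) (div_nonneg_of_nonpos hr.le hneg.le))
    rw [map_smul, smul_eq_mul, div_mul_cancel₀ _ hneg.ne] at h
    exact lt_irrefl _ h
  · rw [InnerProductSpace.toDual_symm_apply]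
    exact hfz.trans hr

/-- The dual cone contains an element that is strictly positive on the nonzero elements of `K`
orthogonal to the lineality space. -/
theorem IsCone.exists_inner_pos [FiniteDimensional ℝ E] {K : Set E} (hK : IsCone K)
    (hconv : Convex ℝ K) (hclosed : IsClosed K) :
    ∃ u ∈ -polarCone K, ∀ w ∈ K, w ∈ (lineality K hK hconv)ᗮ → ‖w‖ = 1 → 0 < ⟪u, w⟫ := by
  set L := lineality K hK hconv with hL
  have hcompact : IsCompact (Metric.sphere (0 : E) 1 ∩ (K ∩ (Lᗮ : Set E))) :=
    (isCompact_sphere 0 1).inter_right (hclosed.inter Lᗮ.closed_of_finiteDimensional)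
  -- Dual vectors give open half-spaces covering the compact unit section of `K ∩ Lᗮ`; the sum over
  -- a finite subcover is positive on all of it.
  obtain ⟨t, ht⟩ := hcompact.elim_finite_subcover
    (fun v : (-polarCone K : Set E) => {w : E | 0 < ⟪(v : E), w⟫})
    (fun v => isOpen_lt continuous_const (by fun_prop)) (by
      rintro w ⟨hw1, hwK, hwL⟩
      have hwneg : -w ∉ K := fun h => by
        have h0 : w = 0 := inner_self_eq_zero.1 (hwL w (show w ∈ L from ⟨hwK, h⟩))
        simp [h0] at hw1
      obtain ⟨v, hv, hvw⟩ := hK.exists_mem_neg_polarCone_inner_neg hconv hclosed hwneg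
      refine Set.mem_iUnion.2 ⟨⟨v, hv⟩, ?_⟩
      simpa [inner_neg_right] using hvw)
  refine ⟨∑ v ∈ t, (v : E), mem_neg_polarCone.2 fun k hk => ?_, fun w hwK hwL hw1 => ?_⟩
  · rw [sum_inner]
    exact Finset.sum_nonneg fun v _ => mem_neg_polarCone.1 v.2 k hk
  · rw [sum_inner]
    obtain ⟨v, hvt, hv⟩ := Set.mem_iUnion₂.1 (ht ⟨by simpa using hw1, hwK, hwL⟩)
    exact Finset.sum_pos' (fun v _ => mem_neg_polarCone.1 v.2 w hwK) ⟨v, hvt, hv⟩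

end Cone

section Epigraph

variable {E₁ E₂ : Type*} [NormedAddCommGroup E₂] [InnerProductSpace ℝ E₂] {D : Set E₁}
  {F : D → E₂} {u : E₂}

theorem mem_epi_scalarization {p : E₁ × ℝ} :
    p ∈ epi (scalarization u F) ↔ ∃ h : p.1 ∈ D, ⟪u, F ⟨p.1, h⟩⟫ ≤ p.2 := by
  by_cases h : p.1 ∈ D <;> simp [epi, scalarization, h]

theorem isProperFun_scalarization (hD : D.Nonempty) : IsProperFun (scalarization u F) := by
  obtain ⟨x, hx⟩ := hD
  refine ⟨⟨x, by simp [scalarization, hx]⟩, fun x => ?_⟩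
  by_cases h : x ∈ D <;> simp [scalarization, h]

end Epigraph

section Scalarization

variable {E₁ E₂ : Type*} [NormedAddCommGroup E₁] [InnerProductSpace ℝ E₁]
  [NormedAddCommGroup E₂] [InnerProductSpace ℝ E₂] {D : Set E₁} {F : D → E₂} {K : Set E₂} {u : E₂}

theorem convex_epi_scalarization (hK : IsCone K) (hconv : Convex ℝ (kEpi K F))
    (hu : u ∈ -polarCone K) : Convex ℝ (epi (scalarization u F)) := by
  rintro ⟨x, a⟩ hp ⟨y, b⟩ hq s t hs ht hst
  obtain ⟨hx, hxa⟩ := mem_epi_scalarization.1 hp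
  obtain ⟨hy, hyb⟩ := mem_epi_scalarization.1 hq
  have hgraph : ∀ (z : E₁) (hz : z ∈ D), (z, F ⟨z, hz⟩) ∈ kEpi K F :=
    fun z hz => ⟨hz, by simpa using hK.zero_mem⟩
  obtain ⟨h, hmem⟩ := hconv (hgraph x hx) (hgraph y hy) hs ht hst
  refine mem_epi_scalarization.2 ⟨h, ?_⟩
  have hpos := mem_neg_polarCone.1 hu _ hmem
  simp only [Prod.smul_mk, Prod.mk_add_mk, inner_sub_right, inner_add_right, inner_smul_right,
    sub_nonneg] at hpos
  exact hpos.trans (add_le_add (mul_le_mul_of_nonneg_left hxa hs)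
    (mul_le_mul_of_nonneg_left hyb ht))

/-- If the scalarization by `u` is convex and `D`-closed, then `u` is in the dual of the smallest
cone. -/
theorem IsSmallestCone.mem_neg_polarCone (hK : IsSmallestCone F K)
    (hu : scalarization u F ∈ GammaZeroOn D) : u ∈ -polarCone K := by
  obtain ⟨⟨hcone, hclosed, hconv, hec, hev⟩, hleast⟩ := hK
  obtain ⟨⟨-, huconv⟩, huclosed⟩ := hu
  set C : Set E₂ := K ∩ {y | 0 ≤ ⟪u, y⟫} with hC
  set φ : E₁ × E₂ →ₗ[ℝ] E₁ × ℝ := LinearMap.prodMap LinearMap.id (innerₛₗ ℝ u) with hφ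
  have hφapp : ∀ p, φ p = (p.1, ⟪u, p.2⟫) := fun p => by simp [hφ]
  have hepi : kEpi C F = kEpi K F ∩ φ ⁻¹' epi (scalarization u F) := by
    ext p
    rw [Set.mem_inter_iff, Set.mem_preimage, hφapp, mem_epi_scalarization]
    simp only [kEpi, hC, Set.mem_ofPred_eq, Set.mem_inter_iff, inner_sub_right, sub_nonneg]
    constructor
    · rintro ⟨h, h1, h2⟩
      exact ⟨⟨h, h1⟩, h, h2⟩
    · rintro ⟨⟨h, h1⟩, _, h2⟩
      exact ⟨h, h1, h2⟩
  have hsub : K ⊆ C := by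
    refine hleast ⟨⟨⟨0, hcone.zero_mem, by simp⟩, ?_⟩, ?_, ?_, ?_, ?_⟩
    · rintro x ⟨hx, hx'⟩ t ht
      refine ⟨hcone.2 x hx t ht, ?_⟩
      rw [Set.mem_ofPred_eq, inner_smul_right]
      exact mul_nonneg ht hx'
    · exact hclosed.inter (isClosed_le continuous_const (by fun_prop))
    · exact hconv.inter ((convex_Ici (0 : ℝ)).linear_preimage (innerₛₗ ℝ u))
    -- Relative closedness suffices because the `K`-epigraph already lies over `D`.
    · obtain ⟨T, hT, hTeq⟩ := isClosed_induced_iff.1 huclosed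
      have h2 : kEpi C F = kEpi K F ∩ φ ⁻¹' T := by
        rw [hepi]
        ext p
        refine and_congr_right fun hp => ?_
        have hD : φ p ∈ D ×ˢ (Set.univ : Set ℝ) := by
          rw [hφapp]
          exact ⟨hp.1, trivial⟩
        exact (Set.ext_iff.1 hTeq ⟨φ p, hD⟩).symm
      rw [h2]
      refine hec.inter (hT.preimage ?_)
      rw [funext hφapp]
      fun_prop
    · rw [hepi]
      exact hev.inter (huconv.linear_preimage φ)
  exact KConvex.mem_neg_polarCone.2 fun k hk => (hsub hk).2

theorem gammaZero_subset_gammaZeroOn : GammaZero E₁ ⊆ GammaZeroOn D :=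
  fun _ hf => ⟨hf.1, hf.2.preimage continuous_subtype_val⟩

/-- Limits of normalized points of the epigraph with norms tending to infinity, over a convergent
sequence of base points, are in the cone. -/
theorem mem_of_tendsto_normalized (hec : IsClosed (kEpi K F)) (hev : Convex ℝ (kEpi K F))
    (hcone : IsCone K) (hD : D.Nonempty) {x : ℕ → E₁} {y : ℕ → E₂} {a : E₁} {w : E₂}
    (hmem : ∀ n, (x n, y n) ∈ kEpi K F) (hx : Tendsto x atTop (𝓝 a))
    (hy : Tendsto (fun n => ‖y n‖) atTop atTop)
    (hw : Tendsto (fun n => ‖y n‖⁻¹ • y n) atTop (𝓝 w)) : w ∈ K := by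
  obtain ⟨x₀, hx₀⟩ := hD
  have h0 : (x₀, F ⟨x₀, hx₀⟩) ∈ kEpi K F := ⟨hx₀, by simpa using hcone.zero_mem⟩
  have hs : Tendsto (fun n => ‖y n‖⁻¹) atTop (𝓝 0) := tendsto_inv_atTop_zero.comp hy
  have hs1 : Tendsto (fun n => 1 - ‖y n‖⁻¹) atTop (𝓝 1) := by
    simpa using hs.const_sub 1
  -- The vanishing weight on the far point loses its base point `x n` but keeps its direction `w`.
  have hlim : Tendsto (fun n => (1 - ‖y n‖⁻¹) • (x₀, F ⟨x₀, hx₀⟩) + ‖y n‖⁻¹ • (x n, y n)) atTop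
      (𝓝 (x₀, F ⟨x₀, hx₀⟩ + w)) := by
    have h1 := (hs1.smul_const x₀).add (hs.smul hx)
    have h2 := (hs1.smul_const (F ⟨x₀, hx₀⟩)).add hw
    simpa using h1.prodMk_nhds h2
  obtain ⟨_, h⟩ := hec.mem_of_tendsto hlim (by
    filter_upwards [hy.eventually_ge_atTop 1] with n hn
    exact hev h0 (hmem n) (sub_nonneg.2 (inv_le_one_of_one_le₀ hn)) (by positivity) (by ring))
  simpa using h

/-- Closedness could fail only if values of `F` escape to infinity along a direction of `K` on which
`u` is not positive; `hpos` excludes this modulo the lineality space. -/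
theorem isClosed_epi_scalarization [FiniteDimensional ℝ E₂] (hcone : IsCone K)
    (hconv : Convex ℝ K) (hec : IsClosed (kEpi K F)) (hev : Convex ℝ (kEpi K F))
    (hD : D.Nonempty) (hu : u ∈ -polarCone K)
    (hpos : ∀ w ∈ K, w ∈ (lineality K hcone hconv)ᗮ → ‖w‖ = 1 → 0 < ⟪u, w⟫) :
    IsClosed (epi (scalarization u F)) := by
  set L := lineality K hcone hconv with hL
  have huK := mem_neg_polarCone.1 hu
  have huL : ∀ l ∈ L, ⟪u, l⟫ = 0 := fun l hl =>
    le_antisymm (by simpa [inner_neg_right] using huK _ hl.2) (huK _ hl.1)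
  refine IsSeqClosed.isClosed fun p q hp hpq => ?_
  choose hpD hple using fun n => mem_epi_scalarization.1 (hp n)
  have hx : Tendsto (fun n => (p n).1) atTop (𝓝 q.1) := (continuous_fst.tendsto q).comp hpq
  have ha : Tendsto (fun n => (p n).2) atTop (𝓝 q.2) := (continuous_snd.tendsto q).comp hpq
  -- Removing the component in `L` changes neither membership in the `K`-epigraph nor the pairing
  -- with `u`, and forces limit directions into `Lᗮ`, where `hpos` applies.
  set y : ℕ → E₂ := fun n => F ⟨(p n).1, hpD n⟩ - L.starProjection (F ⟨(p n).1, hpD n⟩) with hy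
  have hyL : ∀ n, y n ∈ Lᗮ := fun n => L.sub_starProjection_mem_orthogonal _
  have hymem : ∀ n, ((p n).1, y n) ∈ kEpi K F := fun n =>
    ⟨hpD n, by
      have h : L.starProjection (F ⟨(p n).1, hpD n⟩) ∈ L := L.starProjection_apply_mem _
      simpa [hy] using h.2⟩
  have hyle : ∀ n, ⟪u, y n⟫ ≤ (p n).2 := fun n => by
    rw [hy, inner_sub_right, huL _ (L.starProjection_apply_mem _), sub_zero]
    exact hple n
  by_cases hbdd : Tendsto (fun n => ‖y n‖) atTop atTop
  · exfalso
    obtain ⟨w, hw1, ψ, hψ, hw⟩ := tendsto_subseq_of_frequently_bounded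
      (Metric.isBounded_closedBall (x := (0 : E₂)) (r := 1))
      (x := fun n => ‖y n‖⁻¹ • y n) (Eventually.of_forall fun n => by
        rw [mem_closedBall_zero_iff, norm_smul, norm_inv, norm_norm]
        exact inv_mul_le_one).frequently
    have hψt := hψ.tendsto_atTop
    have hbdd' := hbdd.comp hψt
    have hwK : w ∈ K := mem_of_tendsto_normalized hec hev hcone hD (fun n => hymem (ψ n))
      (hx.comp hψt) hbdd' hw
    have hwL : w ∈ Lᗮ := Lᗮ.closed_of_finiteDimensional.mem_of_tendsto hw
      (Eventually.of_forall fun n => Lᗮ.smul_mem _ (hyL _))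
    have hwn : ‖w‖ = 1 := by
      refine tendsto_nhds_unique hw.norm (tendsto_const_nhds.congr' ?_)
      filter_upwards [hbdd'.eventually_gt_atTop 0] with n hn
      simp only [Function.comp_apply] at hn ⊢
      rw [norm_smul, norm_inv, norm_norm, inv_mul_cancel₀ hn.ne']
    have hle : ⟪u, w⟫ ≤ 0 := by
      have h1 : Tendsto (fun n => ‖y (ψ n)‖⁻¹ * (p (ψ n)).2) atTop (𝓝 (0 * q.2)) :=
        (tendsto_inv_atTop_zero.comp hbdd').mul (ha.comp hψt)
      rw [zero_mul] at h1
      refine le_of_tendsto_of_tendsto' ((tendsto_const_nhds (x := u)).inner hw) h1 fun n => ?_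
      simp only [Function.comp_apply, inner_smul_right]
      exact mul_le_mul_of_nonneg_left (hyle _) (by positivity)
    exact (hpos w hwK hwL hwn).not_ge hle
  -- Otherwise some ball contains infinitely many `y n`, and a subsequence converges.
  · rw [tendsto_atTop] at hbdd
    push Not at hbdd
    obtain ⟨R, hR⟩ := hbdd
    obtain ⟨z, -, ψ, hψ, hz⟩ := tendsto_subseq_of_frequently_bounded
      (Metric.isBounded_closedBall (x := (0 : E₂)) (r := R)) (x := y)
      (hR.mono fun n hn => mem_closedBall_zero_iff.2 hn.le)
    obtain ⟨h, hzK⟩ := hec.mem_of_tendsto ((hx.comp hψ.tendsto_atTop).prodMk_nhds hz)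
      (Eventually.of_forall fun n => hymem (ψ n))
    refine mem_epi_scalarization.2 ⟨h, ?_⟩
    have h1 := huK _ hzK
    rw [inner_sub_right, sub_nonneg] at h1
    exact h1.trans (le_of_tendsto_of_tendsto' ((tendsto_const_nhds (x := u)).inner hz)
      (ha.comp hψ.tendsto_atTop) fun n => hyle _)

theorem neg_polarCone_subset_closure [FiniteDimensional ℝ E₂] (hcone : IsCone K)
    (hconv : Convex ℝ K) (hclosed : IsClosed K) (hec : IsClosed (kEpi K F))
    (hev : Convex ℝ (kEpi K F)) (hD : D.Nonempty) :
    -polarCone K ⊆ closure {u : E₂ | scalarization u F ∈ GammaZero E₁} := by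
  intro u hu
  obtain ⟨u₀, hu₀, hpos⟩ := hcone.exists_inner_pos hconv hclosed
  have huK := mem_neg_polarCone.1 hu
  have hu₀K := mem_neg_polarCone.1 hu₀
  have hlim : Tendsto (fun t : ℝ => u + t • u₀) (𝓝[>] 0) (𝓝 u) := by
    have h : Continuous fun t : ℝ => u + t • u₀ := by fun_prop
    simpa using (h.tendsto 0).mono_left nhdsWithin_le_nhds
  refine mem_closure_of_tendsto hlim ?_
  filter_upwards [self_mem_nhdsWithin] with t (ht : 0 < t)
  have hmem : u + t • u₀ ∈ -polarCone K := mem_neg_polarCone.2 fun k hk => by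
    rw [inner_add_left, real_inner_smul_left]
    exact add_nonneg (huK k hk) (mul_nonneg ht.le (hu₀K k hk))
  refine ⟨⟨isProperFun_scalarization hD, convex_epi_scalarization hcone hev hmem⟩,
    isClosed_epi_scalarization hcone hconv hec hev hD hmem fun w hwK hwL hw1 => ?_⟩
  rw [inner_add_left, real_inner_smul_left]
  exact add_pos_of_nonneg_of_pos (huK w hwK) (mul_pos ht (hpos w hwK hwL hw1))

end Scalarization

end KConvex

theorem propositionp {E₁ E₂ : Type*}
    [NormedAddCommGroup E₁] [InnerProductSpace ℝ E₁] [FiniteDimensional ℝ E₁]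
    [NormedAddCommGroup E₂] [InnerProductSpace ℝ E₂] [FiniteDimensional ℝ E₂]
    (D : Set E₁) (hDne : D.Nonempty) (hDconv : Convex ℝ D) (F : D → E₂)
    (Khat : Set E₂) (hKhat : KConvex.IsSmallestCone F Khat) :
    -KConvex.polarCone Khat =
        closure {u : E₂ | KConvex.scalarization u F ∈ KConvex.GammaZero E₁} ∧
      -KConvex.polarCone Khat =
        closure {u : E₂ | KConvex.scalarization u F ∈ KConvex.GammaZeroOn D} := by
  obtain ⟨hcone, hclosed, hconv, hec, hev⟩ := hKhat.1
  have h1 := KConvex.neg_polarCone_subset_closure hcone hconv hclosed hec hev hDne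
  have h2 : closure {u : E₂ | KConvex.scalarization u F ∈ KConvex.GammaZero E₁} ⊆
      closure {u : E₂ | KConvex.scalarization u F ∈ KConvex.GammaZeroOn D} :=
    closure_mono fun u hu => KConvex.gammaZero_subset_gammaZeroOn hu
  have h3 : closure {u : E₂ | KConvex.scalarization u F ∈ KConvex.GammaZeroOn D} ⊆
      -KConvex.polarCone Khat :=
    closure_minimal (fun u hu => hKhat.mem_neg_polarCone hu)
      (KConvex.isClosed_neg_polarCone Khat)
  exact ⟨h1.antisymm (h2.trans h3), (h1.trans h2).antisymm h3⟩
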